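/- For an integer $n\ge 2$ and $z\in\mathbb{C}$ let $\zeta_n(z)=\sum_{k=1}^{n}\frac{1}{k^{z}}$ be the $n$-th partial sum of the Riemann zeta function and $G_n(z)=\zeta_n(-z)=1+2^z+\dots+n^z$. Put $$a_n=\inf\{\operatorname{Re} z: G_n(z)=0\},\qquad b^{(n)}=\sup\{\operatorname{Re} z:\zeta_n(z)=0\},$$ $$R_n=\overline{\{\operatorname{Re} z: G_n(z)=0\}},\qquad R^{(n)}=\overline{\{\operatorname{Re} z:\zeta_n(z)=0\}},$$ the closures being taken in $\mathbb{R}$. Then for every integer $n>2$ the infimum $a_n$ and the supremum $b^{(n)}$ are finite (the sets are non-empty and, respectively, bounded below and bounded above), $a_n=-b^{(n)}$, and there exists $\delta_n>0$ such that $$[a_n,\delta_n]\subset R_n\qquad\text{and}\qquad[-\delta_n,b^{(n)}]\subset R^{(n)},$$ and such that every vertical line contained in the strip $[-\delta_n,b^{(n)}]\times\mathbb{R}$ has infinitely many zeros of $\zeta_n$ arbitrarily close to it: for every $c\in[-\delta_n,b^{(n)}]$ and every $\varepsilon>0$ the set $\{z:\zeta_n(z)=0,\ |\operatorname{Re} z-c|<\varepsilon\}$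 is infinite. -/

import Mathlib

/-- The `n`-th partial sum `ζ_n(z) = ∑_{k=1}^n 1 / k^z` of the Riemann zeta function. -/
noncomputable def zetaPartial (n : ℕ) (z : ℂ) : ℂ :=
  ∑ k ∈ Finset.Icc 1 n, 1 / (k : ℂ) ^ z

/-- The function `G_n(z) = ζ_n(-z) = 1 + 2^z + ⋯ + n^z`. -/
noncomputable def GPartial (n : ℕ) (z : ℂ) : ℂ :=
  zetaPartial n (-z)

/-- The set of real parts of the zeros of `f : ℂ → ℂ`. -/
def realPartsOfZeros (f : ℂ → ℂ) : Set ℝ :=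
  {x : ℝ | ∃ z : ℂ, f z = 0 ∧ z.re = x}

/-- `a_n = inf {Re z : G_n(z) = 0}`. -/
noncomputable def aLower (n : ℕ) : ℝ :=
  sInf (realPartsOfZeros (GPartial n))

/-- `b^{(n)} = sup {Re z : ζ_n(z) = 0}`. -/
noncomputable def bUpper (n : ℕ) : ℝ :=
  sSup (realPartsOfZeros (zetaPartial n))

/-- `R_n`, the closure of `{Re z : G_n(z) = 0}`. -/
def RG (n : ℕ) : Set ℝ :=
  closure (realPartsOfZeros (GPartial n))

/-- `R^{(n)}`, the closure of `{Re z : ζ_n(z) = 0}`. -/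
def RZeta (n : ℕ) : Set ℝ :=
  closure (realPartsOfZeros (zetaPartial n))

/-! By unique factorisation, `GPartial n z` is a polynomial `eulerSum n` evaluated at the point with
coordinates `q ^ z`, `q` prime, which lies on the torus of radii `q ^ Re z`. The logarithms of the
primes are independent over the integers, so Kronecker's theorem lets vertical translations
approximate every rotation of that torus. By Hurwitz, a zero of the polynomial on the torus of radii
`q ^ x` then yields zeros of `GPartial n` near `Re z = x`, arbitrarily high up.

It remains to find torus zeros for `aLower n < x ≤ δ`. A zero of `GPartial n` left of `x` gives a
zero in the polydisc of radii `q ^ x`. By `ne_zero_of_mem_polydisc`, this forces a zero on the torus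
unless some one-variable disc through the positive point `(q ^ x)` contains one. For `x ≤ 0` an
Eneström–Kakeya argument excludes zeros in those discs, and compactness extends this to some `δ >
0`. An explicit zero in the closed unit polydisc starts the argument and gives `aLower n ≤ 0`. -/

open Filter Topology

/-! ### Hurwitz's theorem and zeros in polydiscs -/

/-- Minimum modulus principle on a disc. -/
theorem le_norm_of_forall_mem_sphere_le_norm {f : ℂ → ℂ} (hf : Differentiable ℂ f) {c : ℂ} {r m : ℝ}
    (hr : 0 < r) (hm : 0 < m) (h0 : ∀ z ∈ Metric.closedBall c r, f z ≠ 0)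
    (hs : ∀ z ∈ Metric.sphere c r, m ≤ ‖f z‖) {z : ℂ} (hz : z ∈ Metric.closedBall c r) :
    m ≤ ‖f z‖ := by
  have hcl : closure (Metric.ball c r) = Metric.closedBall c r := closure_ball c hr.ne'
  have hfr : frontier (Metric.ball c r) = Metric.sphere c r := frontier_ball c hr.ne'
  have hd : DiffContOnCl ℂ (fun z => (f z)⁻¹) (Metric.ball c r) :=
    hf.diffContOnCl.inv fun z hz => h0 z (hcl ▸ hz)
  have key := Complex.norm_le_of_forall_mem_frontier_norm_le (f := fun z => (f z)⁻¹) (C := m⁻¹)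
    Metric.isBounded_ball hd (fun z hz => by
      rw [norm_inv]
      exact inv_anti₀ hm (hs z (hfr ▸ hz))) (z := z) (hcl ▸ hz)
  rw [norm_inv] at key
  exact (inv_le_inv₀ (norm_pos_iff.2 (h0 z hz)) hm).1 key

/-- Hurwitz's theorem for a continuous family of entire functions: a zero in a disc on whose
boundary the function does not vanish persists under perturbation. -/
theorem eventually_exists_zero_mem_closedBall {X : Type*} [TopologicalSpace X] {g : X → ℂ → ℂ}
    (hg : Continuous (Function.uncurry g)) (hd : ∀ x, Differentiable ℂ (g x)) {x₀ : X} {c : ℂ}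
    {r : ℝ} (hr : 0 < r) (hs : ∀ z ∈ Metric.sphere c r, g x₀ z ≠ 0)
    (h0 : ∃ z ∈ Metric.closedBall c r, g x₀ z = 0) :
    ∀ᶠ x in 𝓝 x₀, ∃ z ∈ Metric.closedBall c r, g x z = 0 := by
  have hc : Continuous (g x₀) := hg.comp (by fun_prop : Continuous fun z => (x₀, z))
  obtain ⟨z₁, hz₁, hmin⟩ := (isCompact_sphere c r).exists_isMinOn
    (NormedSpace.sphere_nonempty.2 hr.le) hc.norm.continuousOn
  set m := ‖g x₀ z₁‖ with hm
  have hm0 : 0 < m := norm_pos_iff.2 (hs z₁ hz₁)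
  have hclose : ∀ᶠ x in 𝓝 x₀, ∀ z ∈ Metric.closedBall c r, ‖g x z - g x₀ z‖ < m / 3 := by
    refine (isCompact_closedBall c r).eventually_forall_of_forall_eventually fun z _ => ?_
    have : Continuous fun p : X × ℂ => ‖g p.1 p.2 - g x₀ p.2‖ :=
      (hg.sub (hc.comp continuous_snd)).norm
    refine this.continuousAt.eventually_lt_const ?_
    simpa using hm0
  filter_upwards [hclose] with x hx
  by_contra! hne
  obtain ⟨z₂, hz₂, hz₂0⟩ := h0
  -- On the circle `‖g x‖ ≥ m - m / 3`. Without zeros this bound would hold at `z₂` too, where `‖g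
  -- x‖ < m / 3`.
  have h1 := le_norm_of_forall_mem_sphere_le_norm (hd x) hr (m := 2 * m / 3) (by positivity) hne
    (fun z hz => by
      have h2 := hx z (Metric.sphere_subset_closedBall hz)
      have h3 : m ≤ ‖g x₀ z‖ := hmin hz
      have h4 := norm_sub_norm_le (g x₀ z) (g x z)
      rw [norm_sub_rev] at h4
      linarith) hz₂
  have h5 := hx z₂ hz₂
  rw [hz₂0, sub_zero] at h5
  linarith

/-- In a family of entire functions over a connected set of parameters, none vanishing on a given
circle, either all or none vanish in the disc. -/
theorem forall_ne_zero_of_isPreconnected {X : Type*} [TopologicalSpace X] {g : X → ℂ → ℂ}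
    (hg : Continuous (Function.uncurry g)) (hd : ∀ x, Differentiable ℂ (g x)) {A : Set X}
    (hA : IsPreconnected A) {c : ℂ} {r : ℝ} (hr : 0 < r)
    (hs : ∀ x ∈ A, ∀ z ∈ Metric.sphere c r, g x z ≠ 0) {x₀ : X} (hx₀ : x₀ ∈ A)
    (h0 : ∀ z ∈ Metric.closedBall c r, g x₀ z ≠ 0) {x : X} (hx : x ∈ A) :
    ∀ z ∈ Metric.closedBall c r, g x z ≠ 0 := by
  set U : Set X := {x | ∀ z ∈ Metric.closedBall c r, g x z ≠ 0} with hU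
  have hUo : IsOpen U := by
    rw [isOpen_iff_mem_nhds]
    intro y hy
    exact (isCompact_closedBall c r).eventually_forall_of_forall_eventually fun z hz =>
      hg.continuousAt.eventually_ne (hy z hz)
  -- By Hurwitz the complement of `U` is also open along `A`, so connectedness decides.
  have hcover : ∀ y ∈ A, y ∉ U → y ∈ interior Uᶜ := by
    intro y hyA hyU
    rw [mem_interior_iff_mem_nhds]
    have hy : ∃ z ∈ Metric.closedBall c r, g y z = 0 := by
      simpa [hU] using hyU
    filter_upwards [eventually_exists_zero_mem_closedBall hg hd hr (hs y hyA) hy] with w hw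
    simpa [hU] using hw
  by_contra hxU
  obtain ⟨y, -, hyU, hyV⟩ := hA U (interior Uᶜ) hUo isOpen_interior
    (fun y hy => (em (y ∈ U)).imp id (hcover y hy)) ⟨x₀, hx₀, h0⟩ ⟨x, hx, hcover x hx hxU⟩
  exact interior_subset hyV hyU

/-- A function of several complex variables, entire in each of them, which vanishes neither on the
torus `|u i| = r i` nor on the discs `|w| ≤ r i` through a point `b` of the torus, does not vanish
on the closed polydisc. -/
theorem ne_zero_of_mem_polydisc {ι : Type*} [Fintype ι] [DecidableEq ι] {F : (ι → ℂ) → ℂ}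
    (hF : Continuous F) (hd : ∀ u i, Differentiable ℂ fun w => F (Function.update u i w))
    {r : ι → ℝ} (hr : ∀ i, 0 < r i) {b : ι → ℂ} (hb : ∀ i, ‖b i‖ = r i)
    (htorus : ∀ u, (∀ i, ‖u i‖ = r i) → F u ≠ 0)
    (hdisc : ∀ i w, ‖w‖ ≤ r i → F (Function.update b i w) ≠ 0)
    {u : ι → ℂ} (hu : ∀ i, ‖u i‖ ≤ r i) : F u ≠ 0 := by
  -- Induction on the set `T` of coordinates released from circle to disc.
  suffices H : ∀ T : Finset ι, ∀ u : ι → ℂ, (∀ i ∈ T, ‖u i‖ ≤ r i) → (∀ i ∉ T, ‖u i‖ = r i) →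
      F u ≠ 0 from H Finset.univ u (fun i _ => hu i) (fun i hi => absurd (Finset.mem_univ i) hi)
  intro T
  induction T using Finset.induction_on with
  | empty => exact fun u _ h => htorus u fun i => h i (by simp)
  | insert j T hj ih =>
    intro u hu1 hu2
    set s : ι → Set ℂ := fun i =>
      if i ∈ insert j T then Metric.closedBall 0 (r i) else Metric.sphere 0 (r i) with hsdef
    have hA : IsPreconnected (Set.pi Set.univ s) := by
      refine isPreconnected_univ_pi fun i => ?_
      by_cases hi : i ∈ insert j T
      · simp only [hsdef, hi, if_true]
        exact (convex_closedBall 0 (r i)).isPreconnected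
      · simp only [hsdef, hi, if_false]
        exact isPreconnected_sphere (by simp [Complex.rank_real_complex]) 0 (r i)
    have hmem : ∀ v : ι → ℂ, v ∈ Set.pi Set.univ s ↔
        (∀ i ∈ insert j T, ‖v i‖ ≤ r i) ∧ (∀ i ∉ insert j T, ‖v i‖ = r i) := by
      intro v
      simp only [Set.mem_pi, Set.mem_univ, true_imp_iff]
      constructor
      · intro h
        refine ⟨fun i hi => ?_, fun i hi => ?_⟩
        · have := h i
          simpa only [hsdef, hi, if_true, mem_closedBall_zero_iff] using this
        · have := h i
          simpa only [hsdef, hi, if_false, mem_sphere_zero_iff_norm] using this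
      · rintro ⟨h1, h2⟩ i
        by_cases hi : i ∈ insert j T
        · simpa only [hsdef, hi, if_true, mem_closedBall_zero_iff] using h1 i hi
        · simpa only [hsdef, hi, if_false, mem_sphere_zero_iff_norm] using h2 i hi
    -- The `j`-th variable runs over its disc, the others are parameters. The induction hypothesis
    -- handles its boundary circle, and the parameter `b` is the member known to be zero-free.
    have key := forall_ne_zero_of_isPreconnected (g := fun v w => F (Function.update v j w))
      (hF.comp (continuous_fst.update j continuous_snd)) (fun v => hd v j) hA (c := 0) (hr j)
      (fun v hv w hw => by
        rw [hmem] at hv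
        refine ih _ (fun i hi => ?_) fun i hi => ?_
        · rw [Function.update_of_ne (ne_of_mem_of_not_mem hi hj)]
          exact hv.1 i (Finset.mem_insert_of_mem hi)
        · by_cases hij : i = j
          · subst hij
            simpa using hw
          · rw [Function.update_of_ne hij]
            exact hv.2 i (by simp [hij, hi]))
      (x₀ := b) ((hmem b).2 ⟨fun i _ => (hb i).le, fun i _ => hb i⟩)
      (fun w hw => hdisc j w (by simpa using hw)) (x := u) ((hmem u).2 ⟨hu1, hu2⟩) (u j)
      (by simpa using hu1 j (by simp))
    simpa using key

/-! ### Kronecker's theorem -/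

/-- Translation by `1 / (2n)` changes the sign of the character and preserves Haar measure. -/
theorem integral_fourier_haarAddCircle {n : ℤ} (hn : n ≠ 0) :
    ∫ x, fourier n x ∂(AddCircle.haarAddCircle (T := 1)) = 0 := by
  have h := MeasureTheory.integral_eq_zero_of_add_right_eq_neg (μ := AddCircle.haarAddCircle)
    (fourier_add_half_inv_index hn one_pos)
  exact h

/-- Mean value of an exponential monomial along a line in the torus with rationally independent
slopes. -/
theorem tendsto_mean_mFourier {ι : Type*} [Fintype ι] {α : ι → ℝ}
    (hα : ∀ n : ι → ℤ, ∑ i, n i * α i = 0 → n = 0) (a : ℝ) (n : ι → ℤ) :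
    Tendsto (fun L : ℝ => (L : ℂ)⁻¹ *
      ∫ t in a..a + L, UnitAddTorus.mFourier n fun i => ((t * α i : ℝ) : UnitAddCircle)) atTop
      (𝓝 (∫ x, UnitAddTorus.mFourier n x
        ∂(MeasureTheory.Measure.pi fun _ : ι => AddCircle.haarAddCircle (T := 1)))) := by
  by_cases hn : n = 0
  · subst hn
    simp only [UnitAddTorus.mFourier_zero, ContinuousMap.one_apply]
    refine tendsto_const_nhds.congr' ?_
    filter_upwards [eventually_gt_atTop 0] with L hL
    have : (L : ℂ) ≠ 0 := by exact_mod_cast hL.ne'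
    simp [this]
  · have hint : ∫ x, UnitAddTorus.mFourier n x
        ∂(MeasureTheory.Measure.pi fun _ : ι => AddCircle.haarAddCircle (T := 1)) = 0 := by
      obtain ⟨i, hi⟩ := Function.ne_iff.1 hn
      simp only [UnitAddTorus.mFourier, ContinuousMap.coe_mk]
      rw [MeasureTheory.integral_fintype_prod_eq_prod (fun i x => fourier (n i) x)]
      exact Finset.prod_eq_zero (Finset.mem_univ i) (integral_fourier_haarAddCircle hi)
    rw [hint]
    set s : ℝ := ∑ i, n i * α i with hs
    have hs0 : s ≠ 0 := fun h => hn (hα n h)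
    have hexp : ∀ t : ℝ, UnitAddTorus.mFourier n (fun i => ((t * α i : ℝ) : UnitAddCircle)) =
        Complex.exp ((2 * Real.pi * Complex.I * s) * t) := by
      intro t
      simp only [UnitAddTorus.mFourier, ContinuousMap.coe_mk, fourier_coe_apply, hs]
      rw [← Complex.exp_sum]
      congr 1
      push_cast
      rw [Finset.mul_sum, Finset.sum_mul]
      exact Finset.sum_congr rfl fun i _ => by ring
    set c : ℂ := 2 * Real.pi * Complex.I * s with hc
    have hc0 : c ≠ 0 := by
      simp [hc, hs0, Real.pi_ne_zero]
    simp only [hexp, integral_exp_mul_complex hc0]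
    have hnorm : ∀ t : ℝ, ‖Complex.exp (c * t)‖ = 1 := by
      intro t
      rw [Complex.norm_exp]
      simp [hc]
    have hb : ∀ L : ℝ, ‖(Complex.exp (c * ↑(a + L)) - Complex.exp (c * a)) / c‖ ≤ 2 / ‖c‖ := by
      intro L
      rw [norm_div]
      gcongr
      calc _ ≤ _ := norm_sub_le _ _
        _ = 2 := by rw [hnorm, hnorm]; norm_num
    have hz : Tendsto (fun L : ℝ => (L : ℂ)⁻¹) atTop (𝓝 0) := by
      have := (Complex.continuous_ofReal.tendsto 0).comp tendsto_inv_atTop_zero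
      simpa [Function.comp_def] using this
    refine Tendsto.zero_mul_isBoundedUnder_le hz ?_
    exact ⟨2 / ‖c‖, by simpa using Eventually.of_forall (f := atTop) hb⟩

/-- **Kronecker's theorem** (Weyl's proof): a line in the torus with rationally independent slopes
visits every neighbourhood of every point at arbitrarily large times. -/
theorem frequently_line_mem_nhds {ι : Type*} [Fintype ι] {α : ι → ℝ}
    (hα : ∀ n : ι → ℤ, ∑ i, n i * α i = 0 → n = 0) (y : UnitAddTorus ι) {U : Set (UnitAddTorus ι)}
    (hU : U ∈ 𝓝 y) : ∃ᶠ t : ℝ in atTop, (fun i => ((t * α i : ℝ) : UnitAddCircle)) ∈ U := by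
  classical
  set μ := MeasureTheory.Measure.pi fun _ : ι => AddCircle.haarAddCircle (T := 1) with hμ
  intro hev
  obtain ⟨a, ha⟩ := eventually_atTop.1 hev
  obtain ⟨f, hf1, hf0, hf01⟩ := exists_continuous_one_zero_of_isCompact (isCompact_singleton (x := y))
    (isClosed_compl_iff.2 (isOpen_interior (s := U)))
    (by simpa [mem_interior_iff_mem_nhds] using hU)
  have hint : ∀ g : C(UnitAddTorus ι, ℂ), MeasureTheory.Integrable g μ := fun g =>
    g.continuous.integrable_of_hasCompactSupport (HasCompactSupport.of_compactSpace g)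
  have hpos : 0 < ∫ x, f x ∂μ := by
    refine f.continuous.integral_pos_of_hasCompactSupport_nonneg_nonzero
      (HasCompactSupport.of_compactSpace f) (fun x => (hf01.2 x).1) (x := y) ?_
    rw [hf1 rfl]
    simp
  set c := ∫ x, f x ∂μ with hc
  set g : C(UnitAddTorus ι, ℂ) := ⟨fun x => (f x : ℂ), by fun_prop⟩ with hg
  have hgc : ∫ x, g x ∂μ = c := by
    simp only [hg, ContinuousMap.coe_mk, hc]
    exact integral_ofReal
  have hdense : g ∈ closure (Submodule.span ℂ (Set.range (UnitAddTorus.mFourier (d := ι))) :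
      Set C(UnitAddTorus ι, ℂ)) := by
    rw [← Submodule.topologicalClosure_coe, UnitAddTorus.span_mFourier_closure_eq_top]
    trivial
  -- Beyond time `a` the bump `g` vanishes along the line, so the means of `h`, and with them its
  -- integral, are at most `c / 3` in norm. The integral of `h` is also within `c / 3` of `c > 0`, a
  -- contradiction.
  obtain ⟨h, hh, hgh⟩ := Metric.mem_closure_iff.1 hdense (c / 3) (by positivity)
  have hcont : Continuous fun t : ℝ => fun i => ((t * α i : ℝ) : UnitAddCircle) :=
    continuous_pi fun i => (AddCircle.continuous_mk' 1).comp (by fun_prop)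
  have hmean : Tendsto (fun L : ℝ => (L : ℂ)⁻¹ *
      ∫ t in a..a + L, h fun i => ((t * α i : ℝ) : UnitAddCircle)) atTop (𝓝 (∫ x, h x ∂μ)) := by
    clear hgh
    induction hh using Submodule.span_induction with
    | mem x hx =>
      obtain ⟨n, rfl⟩ := hx
      exact tendsto_mean_mFourier hα a n
    | zero => simp
    | add p q _ _ hp hq =>
      have e : ∫ x, (p + q) x ∂μ = ∫ x, p x ∂μ + ∫ x, q x ∂μ :=
        MeasureTheory.integral_add (hint p) (hint q)
      rw [e]
      refine (hp.add hq).congr fun L => ?_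
      have e' := intervalIntegral.integral_add (μ := MeasureTheory.volume)
        ((p.continuous.comp hcont).intervalIntegrable a (a + L))
        ((q.continuous.comp hcont).intervalIntegrable a (a + L))
      rw [← mul_add]
      exact congrArg _ e'.symm
    | smul k p _ hp =>
      have e : ∫ x, (k • p) x ∂μ = k * ∫ x, p x ∂μ :=
        MeasureTheory.integral_const_mul k _
      rw [e]
      refine (hp.const_mul k).congr fun L => ?_
      rw [mul_left_comm, ← intervalIntegral.integral_const_mul]
      rfl
  have hle : ‖∫ x, h x ∂μ‖ ≤ c / 3 := by
    refine le_of_tendsto hmean.norm ?_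
    filter_upwards [eventually_gt_atTop 0] with L hL
    have hb : ‖∫ t in a..a + L, h fun i => ((t * α i : ℝ) : UnitAddCircle)‖ ≤
        c / 3 * |a + L - a| := by
      refine intervalIntegral.norm_integral_le_of_norm_le_const fun t ht => ?_
      rw [Set.uIoc_of_le (by linarith)] at ht
      have h1 : g (fun i => ((t * α i : ℝ) : UnitAddCircle)) = 0 := by
        have := hf0 (x := fun i => ((t * α i : ℝ) : UnitAddCircle))
          fun hmem => ha t ht.1.le (interior_subset hmem)
        simp only [hg, ContinuousMap.coe_mk, this]
        simp
      have h2 := ContinuousMap.dist_apply_le_dist (f := g) (g := h)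
        fun i => ((t * α i : ℝ) : UnitAddCircle)
      rw [h1, dist_zero_left] at h2
      exact h2.trans hgh.le
    rw [norm_mul, norm_inv, Complex.norm_real, Real.norm_of_nonneg hL.le]
    rw [add_sub_cancel_left, abs_of_pos hL] at hb
    rw [inv_mul_le_iff₀ hL]
    linarith
  have hdiff : ‖∫ x, (g x - h x) ∂μ‖ ≤ c / 3 := by
    have := MeasureTheory.norm_integral_le_of_norm_le_const (μ := μ) (f := fun x => g x - h x)
      (C := c / 3) (Eventually.of_forall fun x => by
        rw [← dist_eq_norm]
        exact (ContinuousMap.dist_apply_le_dist x).trans hgh.le)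
    simpa using this
  rw [MeasureTheory.integral_sub (hint g) (hint h), hgc] at hdiff
  have h3 := norm_sub_norm_le (c : ℂ) (∫ x, h x ∂μ)
  rw [Complex.norm_real, Real.norm_of_nonneg hpos.le] at h3
  linarith

/-- Kronecker's theorem on the unit circles of `ℂ`. -/
theorem frequently_exp_mem_nhds {ι : Type*} [Fintype ι] {ω : ι → ℝ}
    (hω : ∀ n : ι → ℤ, ∑ i, n i * ω i = 0 → n = 0) {w : ι → ℂ} (hw : ∀ i, ‖w i‖ = 1)
    {U : Set (ι → ℂ)} (hU : U ∈ 𝓝 w) :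
    ∃ᶠ t : ℝ in atTop, (fun i => Complex.exp (t * ω i * Complex.I)) ∈ U := by
  set φ : UnitAddTorus ι → ι → ℂ := fun x i => fourier 1 (x i) with hφ
  have hφc : Continuous φ := by fun_prop
  have hφe : ∀ s : ι → ℝ, φ (fun i => ((s i / (2 * Real.pi) : ℝ) : UnitAddCircle)) =
      fun i => Complex.exp (s i * Complex.I) := by
    intro s
    funext i
    simp only [hφ, fourier_coe_apply]
    congr 1
    have := Real.pi_ne_zero
    push_cast
    field_simp
  have hy : φ (fun i => (((w i).arg / (2 * Real.pi) : ℝ) : UnitAddCircle)) = w := by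
    rw [hφe]
    funext i
    have := Complex.norm_mul_exp_arg_mul_I (w i)
    rwa [hw, Complex.ofReal_one, one_mul] at this
  have hα : ∀ n : ι → ℤ, ∑ i, n i * (ω i / (2 * Real.pi)) = 0 → n = 0 := by
    intro n hn
    refine hω n ?_
    simp_rw [← mul_div_assoc] at hn
    rw [← Finset.sum_div, div_eq_zero_iff] at hn
    exact hn.resolve_right (by positivity)
  refine (frequently_line_mem_nhds hα _ (hφc.continuousAt (hy.symm ▸ hU))).mono fun t ht => ?_
  have e := hφe fun i => t * ω i
  simp only [Set.mem_preimage, ← mul_div_assoc, e] at ht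
  simpa using ht

/-! ### The polynomial in the primes -/

/-- The prime numbers up to `n`. -/
abbrev PrimesLE (n : ℕ) := {q : ℕ // q ∈ (n + 1).primesBelow}

theorem PrimesLE.prime {n : ℕ} (q : PrimesLE n) : (q : ℕ).Prime :=
  Nat.prime_of_mem_primesBelow q.2

theorem PrimesLE.natCast_ne_zero {n : ℕ} (q : PrimesLE n) : ((q : ℕ) : ℂ) ≠ 0 :=
  Nat.cast_ne_zero.2 q.prime.ne_zero

/-- The polynomial `∑_{k ≤ n} ∏_q u_q ^ v_q(k)` in variables indexed by the primes `q ≤ n`. -/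
noncomputable def eulerSum (n : ℕ) (u : PrimesLE n → ℂ) : ℂ :=
  ∑ k ∈ Finset.Icc 1 n, ∏ q, u q ^ padicValNat q k

theorem continuous_eulerSum (n : ℕ) : Continuous (eulerSum n) := by
  unfold eulerSum
  fun_prop

theorem prod_primesLE_pow_padicValNat {n k : ℕ} (hk : k ∈ Finset.Icc 1 n) :
    ∏ q : PrimesLE n, (q : ℕ) ^ padicValNat q k = k := by
  rw [Finset.mem_Icc] at hk
  have h := Nat.prod_pow_prime_padicValNat k (by omega) (n + 1) (by omega)
  exact (Finset.prod_coe_sort (n + 1).primesBelow fun q => q ^ padicValNat q k).trans h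

theorem natCast_pow_cpow (q m : ℕ) (z : ℂ) : ((q ^ m : ℕ) : ℂ) ^ z = ((q : ℂ) ^ z) ^ m := by
  induction m with
  | zero => simp
  | succ m ih => rw [pow_succ, Nat.cast_mul, Complex.natCast_mul_natCast_cpow, ih, pow_succ]

theorem natCast_prod_cpow {ι : Type*} (s : Finset ι) (a : ι → ℕ) (z : ℂ) :
    ((∏ i ∈ s, a i : ℕ) : ℂ) ^ z = ∏ i ∈ s, (a i : ℂ) ^ z := by
  classical
  induction s using Finset.induction_on with
  | empty => simp
  | insert i s hi ih =>
    rw [Finset.prod_insert hi, Finset.prod_insert hi, Nat.cast_mul,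
      Complex.natCast_mul_natCast_cpow, ih]

theorem prod_primesLE_cpow_pow {n k : ℕ} (hk : k ∈ Finset.Icc 1 n) (z : ℂ) :
    ∏ q : PrimesLE n, (((q : ℕ) : ℂ) ^ z) ^ padicValNat q k = (k : ℂ) ^ z := by
  conv_rhs => rw [← prod_primesLE_pow_padicValNat hk]
  rw [natCast_prod_cpow]
  exact Finset.prod_congr rfl fun q _ => (natCast_pow_cpow _ _ _).symm

/-- For unimodular `v` these are the functions Bohr-equivalent to `GPartial n`; `v q = q ^ (i t)` is
the vertical translation by `t`. -/
theorem eulerSum_cpow_mul (n : ℕ) (z : ℂ) (v : PrimesLE n → ℂ) :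
    eulerSum n (fun q => ((q : ℕ) : ℂ) ^ z * v q) =
      ∑ k ∈ Finset.Icc 1 n, (k : ℂ) ^ z * ∏ q, v q ^ padicValNat q k := by
  refine Finset.sum_congr rfl fun k hk => ?_
  simp_rw [mul_pow]
  rw [Finset.prod_mul_distrib, prod_primesLE_cpow_pow hk]

theorem GPartial_eq_eulerSum (n : ℕ) (z : ℂ) :
    GPartial n z = eulerSum n fun q => ((q : ℕ) : ℂ) ^ z := by
  unfold GPartial zetaPartial eulerSum
  refine Finset.sum_congr rfl fun k hk => ?_
  rw [prod_primesLE_cpow_pow hk, Complex.cpow_neg, one_div, inv_inv]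

/-- The logarithms of the primes are linearly independent over `ℤ`. -/
theorem eq_zero_of_sum_mul_log_eq_zero {n : ℕ} (m : PrimesLE n → ℤ)
    (hm : ∑ q, m q * Real.log ((q : ℕ) : ℝ) = 0) : m = 0 := by
  have hpos : ∀ q : PrimesLE n, (0 : ℝ) < ((q : ℕ) : ℝ) := fun q => by
    exact_mod_cast q.prime.pos
  have hlog : ∀ a : PrimesLE n → ℕ, Real.log ((∏ q : PrimesLE n, (q : ℕ) ^ a q : ℕ) : ℝ) =
      ∑ q, (a q : ℝ) * Real.log ((q : ℕ) : ℝ) := by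
    intro a
    push_cast
    rw [Real.log_prod fun q _ => (pow_pos (hpos q) _).ne']
    simp_rw [Real.log_pow]
  -- Separating positive and negative exponents gives two equal integers. A prime occurring in one
  -- must occur in the other, yet `m q` and `-m q` are never both positive.
  have hprod : ∏ q : PrimesLE n, (q : ℕ) ^ (m q).toNat = ∏ q : PrimesLE n, (q : ℕ) ^ (-m q).toNat := by
    have hp : ∀ a : PrimesLE n → ℕ, (0 : ℝ) < ((∏ q : PrimesLE n, (q : ℕ) ^ a q : ℕ) : ℝ) := fun a => by
      exact Nat.cast_pos.2 (Finset.prod_pos fun q _ => pow_pos q.prime.pos _)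
    have : Real.log ((∏ q : PrimesLE n, (q : ℕ) ^ (m q).toNat : ℕ) : ℝ) =
        Real.log ((∏ q : PrimesLE n, (q : ℕ) ^ (-m q).toNat : ℕ) : ℝ) := by
      rw [hlog, hlog, ← sub_eq_zero, ← Finset.sum_sub_distrib, ← hm]
      refine Finset.sum_congr rfl fun q _ => ?_
      rw [← sub_mul]
      congr 1
      have := Int.toNat_sub_toNat_neg (m q)
      exact_mod_cast this
    exact Nat.cast_injective (Real.log_injOn_pos (Set.mem_Ioi.2 (hp _)) (Set.mem_Ioi.2 (hp _)) this)
  have hdvd : ∀ (a b : PrimesLE n → ℕ), ∏ q : PrimesLE n, (q : ℕ) ^ a q = ∏ q : PrimesLE n, (q : ℕ) ^ b q →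
      ∀ q, a q ≠ 0 → b q ≠ 0 := by
    intro a b hab q hq hb
    have h1 : (q : ℕ) ∣ ∏ q : PrimesLE n, (q : ℕ) ^ b q :=
      hab ▸ (dvd_pow_self _ hq).trans (Finset.dvd_prod_of_mem _ (Finset.mem_univ q))
    obtain ⟨r, -, hr⟩ := (q.prime.prime.dvd_finsetProd_iff _).1 h1
    have hqr : q = r := Subtype.ext
      ((Nat.prime_dvd_prime_iff_eq q.prime r.prime).1 (q.prime.dvd_of_dvd_pow hr))
    subst hqr
    rw [hb, pow_zero] at hr
    exact q.prime.one_lt.ne' (Nat.dvd_one.1 hr)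
  funext q
  have h1 := hdvd _ _ hprod q
  have h2 := hdvd _ _ hprod.symm q
  simp only [Pi.zero_apply]
  omega

theorem norm_natCast_cpow_of_ne_zero {k : ℕ} (hk : k ≠ 0) (z : ℂ) :
    ‖(k : ℂ) ^ z‖ = (k : ℝ) ^ z.re :=
  Complex.norm_natCast_cpow_of_pos (Nat.pos_of_ne_zero hk) z

/-- A uniform zero-free half plane for the twists of `GPartial n`. -/
theorem eulerSum_cpow_mul_ne_zero {n : ℕ} (hn : 0 < n) {v : PrimesLE n → ℂ} (hv : ∀ q, ‖v q‖ = 1)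
    {z : ℂ} (hz : z.re ≤ -n) : eulerSum n (fun q => ((q : ℕ) : ℂ) ^ z * v q) ≠ 0 := by
  rw [eulerSum_cpow_mul, ← Finset.add_sum_Ioc_eq_sum_Icc (by omega : 1 ≤ n)]
  -- The `n - 1` terms with `k ≥ 2` total at most `(n - 1) / 2 ^ n < 1`, so they cannot cancel the
  -- term `k = 1`.
  have hterm : ∀ k ∈ Finset.Ioc 1 n, ‖(k : ℂ) ^ z * ∏ q, v q ^ padicValNat q k‖ ≤
      (2 : ℝ) ^ (-n : ℝ) := by
    intro k hk
    rw [Finset.mem_Ioc] at hk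
    have h2 : (2 : ℝ) ≤ k := by exact_mod_cast hk.1
    rw [norm_mul, norm_prod, norm_natCast_cpow_of_ne_zero (by omega)]
    simp only [norm_pow, hv, one_pow, Finset.prod_const_one, mul_one]
    have h0 : z.re ≤ 0 := hz.trans (by simp)
    exact (Real.rpow_le_rpow_of_nonpos (by norm_num) h2 h0).trans
      (Real.rpow_le_rpow_of_exponent_le (by norm_num) hz)
  have hsum := (norm_sum_le_of_le _ hterm)
  rw [Finset.sum_const, Nat.card_Ioc, nsmul_eq_mul] at hsum
  intro h
  simp only [Nat.cast_one, Complex.one_cpow, padicValNat_one_right, pow_zero, Finset.prod_const_one,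
    mul_one] at h
  rw [add_eq_zero_iff_neg_eq] at h
  rw [← h, norm_neg, norm_one, Real.rpow_neg (by norm_num), Real.rpow_natCast,
    ← div_eq_mul_inv, le_div_iff₀ (by positivity), one_mul] at hsum
  have h3 : n < 2 ^ n := Nat.lt_two_pow_self
  have h4 : 2 ^ n ≤ n - 1 := by exact_mod_cast hsum
  omega

/-! ### Zero-free one-variable fibres -/

/-- The fibre of `eulerSum` over the positive point with coordinates `r ^ x`. -/
theorem eulerSum_update_cpow (n : ℕ) (x : ℂ) (q : PrimesLE n) (u : ℂ) :
    eulerSum n (Function.update (fun r : PrimesLE n => ((r : ℕ) : ℂ) ^ x) q (((q : ℕ) : ℂ) ^ x * u)) =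
      ∑ k ∈ Finset.Icc 1 n, (k : ℂ) ^ x * u ^ padicValNat q k := by
  have : Function.update (fun r : PrimesLE n => ((r : ℕ) : ℂ) ^ x) q (((q : ℕ) : ℂ) ^ x * u) =
      fun r : PrimesLE n => ((r : ℕ) : ℂ) ^ x * Function.update (fun _ : PrimesLE n => (1 : ℂ)) q u r := by
    funext r
    by_cases h : r = q
    · subst h
      simp
    · simp [h]
  rw [this, eulerSum_cpow_mul]
  refine Finset.sum_congr rfl fun k _ => ?_
  rw [Finset.prod_eq_single q]
  · simp
  · intro r _ hr
    simp [hr]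
  · simp

/-- A variant of the Eneström–Kakeya theorem. -/
theorem sum_cpow_mul_pow_padicValNat_ne_zero {n : ℕ} (hn : 2 < n) {q : ℕ} (hq : q.Prime) {x : ℝ}
    (hx : x ≤ 0) {u : ℂ} (hu : ‖u‖ ≤ 1) :
    ∑ k ∈ Finset.Icc 1 n, (k : ℂ) ^ (x : ℂ) * u ^ padicValNat q k ≠ 0 := by
  have := Fact.mk hq
  have hcast : ∀ k : ℕ, (k : ℂ) ^ (x : ℂ) = (((k : ℝ) ^ x : ℝ) : ℂ) := fun k => by
    rw [Complex.ofReal_cpow (Nat.cast_nonneg k)]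
    simp
  simp only [hcast]
  intro h0
  set c : ℕ → ℝ := fun k => (k : ℝ) ^ x - if q * k ≤ n then ((q * k : ℕ) : ℝ) ^ x else 0 with hc
  have hc0 : ∀ k ∈ Finset.Icc 1 n, 0 ≤ c k := by
    intro k hk
    rw [Finset.mem_Icc] at hk
    simp only [hc]
    split_ifs
    · rw [sub_nonneg]
      refine Real.rpow_le_rpow_of_nonpos (by exact_mod_cast hk.1) ?_ hx
      exact_mod_cast Nat.le_mul_of_pos_left k hq.pos
    · simpa using Real.rpow_nonneg (Nat.cast_nonneg k) x
  -- As in Eneström–Kakeya, the sum is multiplied by `w - 1`. The map `k ↦ q * k` raises the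
  -- valuation by one, pairing `k ^ x` with `(q * k) ^ x` and leaving nonnegative coefficients `c
  -- k`.
  have key : ∀ w : ℂ, ∑ k ∈ Finset.Icc 1 n, (c k : ℂ) * w ^ (padicValNat q k + 1) =
      ∑ k ∈ Finset.Icc 1 n with ¬ q ∣ k, (((k : ℝ) ^ x : ℝ) : ℂ) +
      (w - 1) * ∑ k ∈ Finset.Icc 1 n, (((k : ℝ) ^ x : ℝ) : ℂ) * w ^ padicValNat q k := by
    intro w
    have hmul : ∑ k ∈ Finset.Icc 1 n with q ∣ k, (((k : ℝ) ^ x : ℝ) : ℂ) * w ^ padicValNat q k =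
        ∑ k ∈ Finset.Icc 1 n with q * k ≤ n,
          ((((q * k : ℕ) : ℝ) ^ x : ℝ) : ℂ) * w ^ (padicValNat q k + 1) := by
      symm
      refine Finset.sum_bij (fun k _ => q * k) ?_ ?_ ?_ ?_
      · intro k hk
        simp only [Finset.mem_filter, Finset.mem_Icc] at hk ⊢
        exact ⟨⟨Nat.mul_pos hq.pos hk.1.1, hk.2⟩, dvd_mul_right _ _⟩
      · intro a _ b _ hab
        exact Nat.eq_of_mul_eq_mul_left hq.pos hab
      · intro b hb
        simp only [Finset.mem_filter, Finset.mem_Icc] at hb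
        obtain ⟨⟨hb1, hb2⟩, k, rfl⟩ := hb
        refine ⟨k, ?_, rfl⟩
        simp only [Finset.mem_filter, Finset.mem_Icc]
        exact ⟨⟨Nat.pos_of_mul_pos_left hb1, (Nat.le_mul_of_pos_left k hq.pos).trans hb2⟩, hb2⟩
      · intro k hk
        simp only [Finset.mem_filter, Finset.mem_Icc] at hk
        rw [padicValNat.mul hq.ne_zero (by omega), padicValNat_self, add_comm]
    have hnd : ∑ k ∈ Finset.Icc 1 n with ¬ q ∣ k, (((k : ℝ) ^ x : ℝ) : ℂ) * w ^ padicValNat q k =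
        ∑ k ∈ Finset.Icc 1 n with ¬ q ∣ k, (((k : ℝ) ^ x : ℝ) : ℂ) := by
      refine Finset.sum_congr rfl fun k hk => ?_
      rw [Finset.mem_filter] at hk
      simp [padicValNat.eq_zero_of_not_dvd hk.2]
    have hsplit := Finset.sum_filter_add_sum_filter_not (Finset.Icc 1 n) (fun k => q ∣ k)
      fun k => (((k : ℝ) ^ x : ℝ) : ℂ) * w ^ padicValNat q k
    rw [hmul, hnd, Finset.sum_filter] at hsplit
    have hL : ∑ k ∈ Finset.Icc 1 n, (c k : ℂ) * w ^ (padicValNat q k + 1) =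
        w * ∑ k ∈ Finset.Icc 1 n, (((k : ℝ) ^ x : ℝ) : ℂ) * w ^ padicValNat q k -
        ∑ k ∈ Finset.Icc 1 n, if q * k ≤ n then
          ((((q * k : ℕ) : ℝ) ^ x : ℝ) : ℂ) * w ^ (padicValNat q k + 1) else 0 := by
      rw [Finset.mul_sum, ← Finset.sum_sub_distrib]
      refine Finset.sum_congr rfl fun k _ => ?_
      simp only [hc]
      split_ifs
      · rw [Complex.ofReal_sub]
        ring
      · rw [sub_zero]
        ring
    linear_combination hL - hsplit
  have hdiff : ∑ k ∈ Finset.Icc 1 n, (c k : ℂ) * (1 - u ^ (padicValNat q k + 1)) = 0 := by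
    have h1 := key 1
    have h2 := key u
    rw [h0, mul_zero, add_zero] at h2
    rw [sub_self, zero_mul, add_zero] at h1
    simp only [one_pow, mul_one] at h1
    simp only [mul_sub, mul_one, Finset.sum_sub_distrib]
    rw [h1, h2, sub_self]
  -- Every summand is nonnegative because `‖u‖ ≤ 1`, hence every summand is zero.
  have hre : ∑ k ∈ Finset.Icc 1 n, c k * (1 - (u ^ (padicValNat q k + 1)).re) = 0 := by
    have := congrArg Complex.re hdiff
    simpa [Complex.re_sum] using this
  have hpow : ∀ m : ℕ, (u ^ m).re ≤ 1 := fun m =>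
    (Complex.re_le_norm _).trans (by rw [norm_pow]; exact pow_le_one₀ (norm_nonneg _) hu)
  have hall := (Finset.sum_eq_zero_iff_of_nonneg fun k hk =>
    mul_nonneg (hc0 k hk) (sub_nonneg.2 (hpow _))).1 hre
  -- One of `n - 1`, `n` is prime to `q`. For it `q * k > n`, as `n > 2`, so `c k = k ^ x > 0` and
  -- the exponent is one; this forces `u = 1`, where the sum is positive.
  obtain ⟨k, hk1, hk2, hk3⟩ : ∃ k, n - 1 ≤ k ∧ k ≤ n ∧ ¬ q ∣ k := by
    by_cases h : q ∣ n
    · refine ⟨n - 1, le_rfl, by omega, fun h' => ?_⟩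
      have := (Nat.dvd_sub h h')
      rw [show n - (n - 1) = 1 by omega] at this
      exact hq.one_lt.ne' (Nat.dvd_one.1 this)
    · exact ⟨n, by omega, le_rfl, h⟩
  have hk := hall k (Finset.mem_Icc.2 ⟨by omega, hk2⟩)
  have hqk : ¬ q * k ≤ n := by
    have := Nat.mul_le_mul hq.two_le hk1
    omega
  have hkpos : (0 : ℝ) < (k : ℝ) ^ x := Real.rpow_pos_of_pos (by exact_mod_cast (by omega : 0 < k)) x
  simp only [hc, hqk, if_false, sub_zero, padicValNat.eq_zero_of_not_dvd hk3, zero_add, pow_one,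
    mul_eq_zero, hkpos.ne', false_or] at hk
  have hu1 : u = 1 := by
    have h1 : u.re = 1 := by linarith
    have h2 : u.re * u.re + u.im * u.im ≤ 1 := by
      rw [← Complex.normSq_apply, Complex.normSq_eq_norm_sq]
      exact pow_le_one₀ (norm_nonneg _) hu
    have h3 : u.im = 0 := by
      rw [h1] at h2
      nlinarith [mul_self_nonneg u.im]
    exact Complex.ext (by simpa using h1) (by simpa using h3)
  rw [hu1] at h0
  simp only [one_pow, mul_one] at h0
  rw [← Complex.ofReal_sum, Complex.ofReal_eq_zero] at h0
  have : 0 < ∑ k ∈ Finset.Icc 1 n, (k : ℝ) ^ x := Finset.sum_pos (fun k hk =>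
    Real.rpow_pos_of_pos (by exact_mod_cast (Finset.mem_Icc.1 hk).1) x)
    ⟨1, Finset.mem_Icc.2 ⟨le_rfl, by omega⟩⟩
  exact this.ne' h0

/-- The closed interval of abscissae on which the one-variable fibres have no zeros extends slightly
to the right of `0`. -/
theorem exists_pos_forall_eulerSum_update_ne_zero {n : ℕ} (hn : 2 < n) :
    ∃ δ : ℝ, 0 < δ ∧ ∀ x ≤ δ, ∀ (q : PrimesLE n) (u : ℂ), ‖u‖ ≤ 1 →
      eulerSum n (Function.update (fun r : PrimesLE n => ((r : ℕ) : ℂ) ^ (x : ℂ)) q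
        (((q : ℕ) : ℂ) ^ (x : ℂ) * u)) ≠ 0 := by
  simp only [eulerSum_update_cpow]
  have hev : ∀ᶠ x : ℝ in 𝓝 0, ∀ q : PrimesLE n, ∀ u ∈ Metric.closedBall (0 : ℂ) 1,
      ∑ k ∈ Finset.Icc 1 n, (k : ℂ) ^ (x : ℂ) * u ^ padicValNat q k ≠ 0 := by
    refine eventually_all.2 fun q => ?_
    refine (isCompact_closedBall _ _).eventually_forall_of_forall_eventually fun u hu => ?_
    have hcont : Continuous fun p : ℝ × ℂ =>
        ∑ k ∈ Finset.Icc 1 n, (k : ℂ) ^ (p.1 : ℂ) * p.2 ^ padicValNat q k := by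
      refine continuous_finsetSum _ fun k hk => ?_
      have hk0 : (k : ℂ) ≠ 0 := Nat.cast_ne_zero.2 (by have := Finset.mem_Icc.1 hk; omega)
      exact ((Complex.continuous_ofReal.comp continuous_fst).const_cpow (Or.inl hk0)).mul
        (continuous_snd.pow _)
    exact hcont.continuousAt.eventually_ne
      (sum_cpow_mul_pow_padicValNat_ne_zero hn q.prime le_rfl (by simpa using hu))
  obtain ⟨δ, hδ, hball⟩ := Metric.eventually_nhds_iff.1 hev
  refine ⟨δ / 2, by positivity, fun x hx q u hu => ?_⟩
  rcases le_or_gt x 0 with h | h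
  · exact sum_cpow_mul_pow_padicValNat_ne_zero hn q.prime h hu
  · refine hball ?_ q u (by simpa using hu)
    rw [Real.dist_eq, sub_zero, abs_of_pos h]
    linarith

/-! ### Zeros on tori and Bohr equivalence -/

/-- If the one-variable fibres have no zeros, a zero in the polydisc forces a zero on the torus. -/
theorem exists_torus_zero {n : ℕ} {x : ℝ}
    (hx : ∀ (q : PrimesLE n) (u : ℂ), ‖u‖ ≤ 1 →
      eulerSum n (Function.update (fun r : PrimesLE n => ((r : ℕ) : ℂ) ^ (x : ℂ)) q
        (((q : ℕ) : ℂ) ^ (x : ℂ) * u)) ≠ 0) {u : PrimesLE n → ℂ}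
    (hu : ∀ q, ‖u q‖ ≤ ((q : ℕ) : ℝ) ^ x) (h0 : eulerSum n u = 0) :
    ∃ v : PrimesLE n → ℂ, (∀ q, ‖v q‖ = ((q : ℕ) : ℝ) ^ x) ∧ eulerSum n v = 0 := by
  by_contra! hne
  have hpos : ∀ q : PrimesLE n, 0 < ((q : ℕ) : ℝ) ^ x := fun q =>
    Real.rpow_pos_of_pos (by exact_mod_cast q.prime.pos) x
  have hnorm : ∀ q : PrimesLE n, ‖((q : ℕ) : ℂ) ^ (x : ℂ)‖ = ((q : ℕ) : ℝ) ^ x := fun q => by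
    rw [norm_natCast_cpow_of_ne_zero q.prime.ne_zero, Complex.ofReal_re]
  refine ne_zero_of_mem_polydisc (continuous_eulerSum n) (fun v i => ?_) hpos
    (b := fun r : PrimesLE n => ((r : ℕ) : ℂ) ^ (x : ℂ)) hnorm hne (fun q w hw => ?_) hu h0
  · unfold eulerSum
    refine Differentiable.fun_sum fun k _ => Differentiable.fun_finsetProd fun q _ => ?_
    by_cases hq : q = i
    · subst hq
      simp only [Function.update_self]
      fun_prop
    · simp only [Function.update_of_ne hq]
      fun_prop
  · have hq0 : ((q : ℕ) : ℂ) ^ (x : ℂ) ≠ 0 := by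
      rw [← norm_pos_iff, hnorm]
      exact hpos q
    have := hx q (w / ((q : ℕ) : ℂ) ^ (x : ℂ)) (by
      rw [norm_div, hnorm]
      exact div_le_one_of_le₀ hw (hpos q).le)
    rwa [mul_div_cancel₀ _ hq0] at this

/-- A zero of `eulerSum n` in the closed unit polydisc, from a prime in `(n / 2, n]`. -/
theorem exists_eulerSum_eq_zero {n : ℕ} (hn : 2 ≤ n) :
    ∃ u : PrimesLE n → ℂ, (∀ q, ‖u q‖ ≤ 1) ∧ eulerSum n u = 0 := by
  obtain ⟨p, hp, hp1, hp2⟩ := Nat.exists_prime_lt_and_le_two_mul (n / 2) (by omega)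
  have hpn : p ∈ (n + 1).primesBelow := Nat.mem_primesBelow.2 ⟨by omega, hp⟩
  -- Since `2 * p > n`, every `k` other than `1` and `p` has a prime factor different from `p`. Only
  -- the terms `1` and `-1` survive.
  refine ⟨fun q => if (q : ℕ) = p then -1 else 0, fun q => by beta_reduce; split_ifs <;> simp, ?_⟩
  unfold eulerSum
  have := Fact.mk hp
  have h1 : (1 : ℕ) ∈ Finset.Icc 1 n := Finset.mem_Icc.2 ⟨le_rfl, by omega⟩
  have hpI : p ∈ Finset.Icc 1 n := Finset.mem_Icc.2 ⟨hp.pos, by omega⟩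
  rw [Finset.sum_eq_add_of_mem 1 p h1 hpI hp.one_lt.ne]
  · have hprod : ∏ q : PrimesLE n, (if (q : ℕ) = p then (-1 : ℂ) else 0) ^ padicValNat q p = -1 := by
      rw [Finset.prod_eq_single (⟨p, hpn⟩ : PrimesLE n) (fun q _ hq => ?_) (by simp)]
      · simp
      have hqp : (q : ℕ) ≠ p := fun h => hq (Subtype.ext h)
      rw [padicValNat.eq_zero_of_not_dvd
        (fun h => hqp ((Nat.prime_dvd_prime_iff_eq (PrimesLE.prime q) hp).1 h)), pow_zero]
    rw [hprod, Finset.prod_eq_one fun q _ => by simp, add_neg_cancel]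
  · rintro k hk ⟨hk1, hkp⟩
    rw [Finset.mem_Icc] at hk
    have hf := Nat.minFac_prime hk1
    have hfk := Nat.minFac_dvd k
    have hfn : k.minFac ∈ (n + 1).primesBelow :=
      Nat.mem_primesBelow.2 ⟨by have := Nat.le_of_dvd (by omega) hfk; omega, hf⟩
    refine Finset.prod_eq_zero (Finset.mem_univ (⟨k.minFac, hfn⟩ : PrimesLE n)) ?_
    have hne : k.minFac ≠ p := by
      intro h
      rw [h] at hfk
      obtain ⟨m, rfl⟩ := hfk
      rcases m with _ | _ | m
      · omega
      · omega
      · have : p * 2 ≤ p * (m + 1 + 1) := Nat.mul_le_mul_left p (by omega)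
        omega
    have := Fact.mk hf
    have hv : padicValNat k.minFac k ≠ 0 := 
      Nat.one_le_iff_ne_zero.1 (one_le_padicValNat_of_dvd (by omega) hfk)
    simp [hne, hv]

/-- Bohr's equivalence principle for `GPartial n`: a zero of `eulerSum n` on the torus of radii
`q ^ x` produces zeros of `GPartial n` near the line `Re z = x`, arbitrarily high up. -/
theorem exists_GPartial_eq_zero_of_torus_zero {n : ℕ} (hn : 0 < n) {x : ℝ} {v : PrimesLE n → ℂ}
    (hv : ∀ q, ‖v q‖ = ((q : ℕ) : ℝ) ^ x) (h0 : eulerSum n v = 0) {ε : ℝ} (hε : 0 < ε) (T : ℝ) :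
    ∃ z : ℂ, GPartial n z = 0 ∧ |z.re - x| < ε ∧ T < z.im := by
  have hpos : ∀ q : PrimesLE n, 0 < ((q : ℕ) : ℝ) ^ x := fun q =>
    Real.rpow_pos_of_pos (by exact_mod_cast q.prime.pos) x
  have hnorm : ∀ q : PrimesLE n, ‖((q : ℕ) : ℂ) ^ (x : ℂ)‖ = ((q : ℕ) : ℝ) ^ x := fun q => by
    rw [norm_natCast_cpow_of_ne_zero q.prime.ne_zero, Complex.ofReal_re]
  set g : (PrimesLE n → ℂ) → ℂ → ℂ := fun w z => eulerSum n fun q => ((q : ℕ) : ℂ) ^ z * w q with hg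
  have hgc : Continuous (Function.uncurry g) := by
    refine (continuous_eulerSum n).comp (continuous_pi fun q => ?_)
    exact (continuous_snd.const_cpow (Or.inl q.natCast_ne_zero)).mul
      ((continuous_apply q).comp continuous_fst)
  have hgd : ∀ w, Differentiable ℂ (g w) := by
    intro w
    simp only [hg, eulerSum_cpow_mul]
    refine Differentiable.fun_sum fun k hk => ?_
    have hk0 : (k : ℂ) ≠ 0 := Nat.cast_ne_zero.2 (by have := Finset.mem_Icc.1 hk; omega)
    exact (differentiable_id.const_cpow (Or.inl hk0)).mul_const _
  set χ : PrimesLE n → ℂ := fun q => v q / ((q : ℕ) : ℂ) ^ (x : ℂ) with hχ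
  have hχ1 : ∀ q, ‖χ q‖ = 1 := fun q => by
    rw [hχ, norm_div, hnorm, hv, div_self (hpos q).ne']
  have hχ0 : g χ x = 0 := by
    rw [← h0]
    simp only [hg, hχ]
    congr 1
    funext q
    refine mul_div_cancel₀ _ ?_
    rw [← norm_pos_iff, hnorm]
    exact hpos q
  -- The zero at `x` is isolated, since the zero-free half plane keeps `g χ` from vanishing
  -- identically.
  have hiso : ∀ᶠ z in 𝓝[≠] (x : ℂ), g χ z ≠ 0 := by
    refine ((hgd χ).analyticAt x).eventually_eq_zero_or_eventually_ne_zero.resolve_left fun h => ?_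
    have h1 : Set.EqOn (g χ) 0 Set.univ :=
      AnalyticOnNhd.eqOn_zero_of_preconnected_of_eventuallyEq_zero
        (fun z _ => (hgd χ).analyticAt z) isPreconnected_univ (Set.mem_univ (x : ℂ)) h
    exact eulerSum_cpow_mul_ne_zero hn hχ1 (z := -(n : ℂ)) (by simp) (h1 (Set.mem_univ _))
  rw [eventually_nhdsWithin_iff, Metric.eventually_nhds_iff] at hiso
  obtain ⟨r₀, hr₀, hball⟩ := hiso
  set r := min r₀ ε / 2 with hr
  have hrpos : 0 < r := by positivity
  have hr1 : r < r₀ := by have := min_le_left r₀ ε; linarith [lt_min hr₀ hε]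
  have hr2 : r < ε := by have := min_le_right r₀ ε; linarith [lt_min hr₀ hε]
  have hpersist := eventually_exists_zero_mem_closedBall hgc hgd hrpos
    (fun z hz => hball (y := z) (by rw [Metric.mem_sphere.1 hz]; exact hr1) (by
      rintro rfl
      rw [Metric.mem_sphere, dist_self] at hz
      exact hrpos.ne hz)) ⟨(x : ℂ), Metric.mem_closedBall_self hrpos.le, hχ0⟩
  have hfreq := frequently_exp_mem_nhds (ω := fun q : PrimesLE n => Real.log ((q : ℕ) : ℝ))
    eq_zero_of_sum_mul_log_eq_zero hχ1 hpersist
  -- The twist by `exp (i t log q)` is translation by `i t`; `t > T + r` absorbs an imaginary part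
  -- of `z` as low as `-r`.
  obtain ⟨t, ⟨z, hz, hz0⟩, ht⟩ := (hfreq.and_eventually (eventually_gt_atTop (T + r))).exists
  rw [Metric.mem_closedBall, dist_eq_norm] at hz
  have hre : |z.re - x| ≤ r := by
    simpa using (Complex.abs_re_le_norm _).trans hz
  have him : |z.im| ≤ r := by
    simpa using (Complex.abs_im_le_norm _).trans hz
  refine ⟨z + t * Complex.I, ?_, ?_, ?_⟩
  · rw [GPartial_eq_eulerSum, ← hz0]
    simp only [hg]
    congr 1
    funext q
    rw [Complex.cpow_add _ _ q.natCast_ne_zero]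
    congr 1
    rw [Complex.cpow_def_of_ne_zero q.natCast_ne_zero, Complex.natCast_log]
    congr 1
    ring
  · simpa using hre.trans_lt hr2
  · have := abs_le.1 him
    simp
    linarith

/-! ### Passage to real parts and conclusion -/

theorem zetaPartial_neg (n : ℕ) (z : ℂ) : zetaPartial n (-z) = GPartial n z := rfl

theorem realPartsOfZeros_zetaPartial (n : ℕ) :
    realPartsOfZeros (zetaPartial n) = -realPartsOfZeros (GPartial n) := by
  ext x
  constructor
  · rintro ⟨z, hz, rfl⟩
    exact ⟨-z, by rw [← zetaPartial_neg, neg_neg, hz], by simp⟩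
  · rintro ⟨z, hz, hx⟩
    exact ⟨-z, by rw [zetaPartial_neg, hz], by rw [Complex.neg_re, hx, neg_neg]⟩

theorem bddBelow_realPartsOfZeros_GPartial {n : ℕ} (hn : 0 < n) :
    BddBelow (realPartsOfZeros (GPartial n)) := by
  refine ⟨-n, ?_⟩
  rintro _ ⟨z, hz, rfl⟩
  by_contra! h
  refine eulerSum_cpow_mul_ne_zero hn (v := fun _ => 1) (by simp) h.le ?_
  simpa [GPartial_eq_eulerSum] using hz

theorem theorem17 (n : ℕ) (hn : 2 < n) :
    IsGLB (realPartsOfZeros (GPartial n)) (aLower n) ∧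
    IsLUB (realPartsOfZeros (zetaPartial n)) (bUpper n) ∧
    aLower n = -bUpper n ∧
    ∃ δ : ℝ, 0 < δ ∧
      Set.Icc (aLower n) δ ⊆ RG n ∧
      Set.Icc (-δ) (bUpper n) ⊆ RZeta n ∧
      ∀ c ∈ Set.Icc (-δ) (bUpper n), ∀ ε : ℝ, 0 < ε →
        {z : ℂ | zetaPartial n z = 0 ∧ |z.re - c| < ε}.Infinite := by
  have hn0 : 0 < n := by omega
  obtain ⟨δ, hδ, hfib⟩ := exists_pos_forall_eulerSum_update_ne_zero hn
  have hzero : ∀ ε > 0, ∃ z : ℂ, GPartial n z = 0 ∧ |z.re| < ε := by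
    intro ε hε
    obtain ⟨u, hu, hu0⟩ := exists_eulerSum_eq_zero (n := n) (by omega)
    obtain ⟨v, hv, hv0⟩ := exists_torus_zero (hfib 0 hδ.le) (by simpa using hu) hu0
    obtain ⟨z, hz, hz', -⟩ := exists_GPartial_eq_zero_of_torus_zero hn0 hv hv0 hε 0
    exact ⟨z, hz, by simpa using hz'⟩
  have hne : (realPartsOfZeros (GPartial n)).Nonempty := by
    obtain ⟨z, hz, -⟩ := hzero 1 one_pos
    exact ⟨z.re, z, hz, rfl⟩
  have hbdd := bddBelow_realPartsOfZeros_GPartial hn0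
  have hglb : IsGLB (realPartsOfZeros (GPartial n)) (aLower n) := isGLB_csInf hne hbdd
  have hab : bUpper n = -aLower n := by
    rw [bUpper, realPartsOfZeros_zetaPartial, aLower, Real.sSup_neg]
  have ha0 : aLower n ≤ 0 := by
    refine le_of_forall_pos_le_add fun ε hε => ?_
    obtain ⟨z, hz, hz'⟩ := hzero ε hε
    have h1 := hglb.1 ⟨z, hz, rfl⟩
    have h2 := (abs_lt.1 hz').2
    linarith
  have hinterior : ∀ x, aLower n < x → x ≤ δ → ∀ ε > 0, ∀ T,
      ∃ z : ℂ, GPartial n z = 0 ∧ |z.re - x| < ε ∧ T < z.im := by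
    intro x hx hxδ ε hε T
    obtain ⟨_, ⟨z, hz, rfl⟩, hzx⟩ := (isGLB_lt_iff hglb).1 hx
    rw [GPartial_eq_eulerSum] at hz
    obtain ⟨v, hv, hv0⟩ := exists_torus_zero (hfib x hxδ) (fun q => by
      rw [norm_natCast_cpow_of_ne_zero q.prime.ne_zero]
      exact Real.rpow_le_rpow_of_exponent_le (by exact_mod_cast q.prime.one_lt.le) hzx.le) hz
    exact exists_GPartial_eq_zero_of_torus_zero hn0 hv hv0 hε T
  have hzeros : ∀ x ∈ Set.Icc (aLower n) δ, ∀ ε > 0, ∀ T,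
      ∃ z : ℂ, GPartial n z = 0 ∧ |z.re - x| < ε ∧ T < z.im := by
    rintro x ⟨hx1, hx2⟩ ε hε T
    rcases hx1.lt_or_eq with hx | rfl
    · exact hinterior x hx hx2 ε hε T
    -- The left endpoint is approached from the right; the shifted abscissa stays below `δ` because
    -- `aLower n ≤ 0`.
    · have hm : 0 < min δ (ε / 2) := by positivity
      obtain ⟨z, hz, hz1, hz2⟩ := hinterior (aLower n + min δ (ε / 2)) (by linarith)
        (by linarith [min_le_left δ (ε / 2)]) (ε / 2) (by positivity) T
      refine ⟨z, hz, ?_, hz2⟩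
      rw [abs_lt] at hz1 ⊢
      constructor <;> linarith [min_le_right δ (ε / 2)]
  have hRG : Set.Icc (aLower n) δ ⊆ RG n := by
    intro x hx
    refine Metric.mem_closure_iff.2 fun ε hε => ?_
    obtain ⟨z, hz, hz', -⟩ := hzeros x hx ε hε 0
    exact ⟨z.re, ⟨z, hz, rfl⟩, by rwa [dist_comm, Real.dist_eq]⟩
  have hmem : ∀ c ∈ Set.Icc (-δ) (bUpper n), -c ∈ Set.Icc (aLower n) δ := fun c hc =>
    ⟨by linarith [hc.2], by linarith [hc.1]⟩
  refine ⟨hglb, ?_, by rw [hab, neg_neg], δ, hδ, hRG, fun c hc => ?_, fun c hc ε hε => ?_⟩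
  · rw [realPartsOfZeros_zetaPartial, hab]
    exact hglb.neg
  · have := hRG (hmem c hc)
    rw [RG, ← Set.mem_neg, neg_closure] at this
    rwa [RZeta, realPartsOfZeros_zetaPartial]
  -- Infinitude follows from zeros of unbounded height; the sign reflects `z ↦ -z`.
  · refine Set.Infinite.of_image (fun z => -z.im) (Set.infinite_of_not_bddAbove ?_)
    rintro ⟨B, hB⟩
    obtain ⟨z, hz, hz1, hz2⟩ := hzeros (-c) (hmem c hc) ε hε B
    refine absurd (hB ⟨-z, ⟨hz, ?_⟩, rfl⟩) ?_
    · rw [abs_sub_comm]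
      convert hz1 using 2
      rw [Complex.neg_re]
      ring
    · simpa using hz2
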